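/- All graphs are finite and simple. A $\mathbb{T}$-gain graph $\Phi=(G,\varphi)$ on a graph $G$ is a map $\varphi$ from the oriented edges of $G$ to the complex unit circle $\mathbb{T}$ with $\varphi(\overrightarrow{e_{ts}})=\varphi(\overrightarrow{e_{st}})^{-1}$. Its adjacency matrix $A(\Phi)$ is the Hermitian matrix with $(s,t)$ entry $\varphi(\overrightarrow{e_{st}})$ if $v_s\sim v_t$ and $0$ otherwise. Write $\lambda_1(A)$ for the largest eigenvalue and $\rho(A)$ for the spectral radius of a Hermitian matrix $A$. A normal spanning tree of a connected graph $G$ is a rooted spanning tree $T$, with root $r$, such that for any two adjacent vertices $x,y$ of $G$, either $x$ lies on the path of $T$ from $r$ to $y$, or $y$ lies on the path of $T$ from $r$ to $x$. The fundamental cycles of $G$ with respect to $T$ are the unique cycles of $T\cup\{e\}$, for $e\in E(G)\setminus E(T)$. The sum $H_1+H_2$ of two subgraphs is their union. A fundamental subgraph of $G$ with respect to $T$ is the sum $\mathfrak{B}$ of a collection $S$ of fundamental cycles that is maximal among the collections whose sum meets $T$ in a (nonempty) subtree. (a) $\mathfrak{B}$ has the distinguished edge property if the cycles of $S$ can be arranged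 in a sequence $(C_1,\dots,C_s)$ such that $|E(C_i)\setminus E(C_1+\cdots+C_{i-1})|>1$ for all $i=2,\dots,s$. (b) $\mathfrak{B}$ has the distinguished edge property relative to a subdivision of $K_4$ if $S$ contains three distinct cycles whose sum $K_4'$ is $K_4$ or a graph obtained from $K_4$ by a sequence of edge subdivisions, and the other cycles of $S$ can be arranged in a sequence $(C_1,\dots,C_s)$ (possibly empty) such that $|E(C_i)\setminus E(K_4'+C_1+\cdots+C_{i-1})|>1$ for all $i=1,\dots,s$. Let $\mathfrak{F}'$ be the class of the connected graphs $G$ (those with the extended distinguished edge property) that have a normal spanning tree $T$ such that every fundamental subgraph of $G$ with respect to $T$ satisfies (a) or (b). **Theorem.** Let $G$ be a connected graph. If $G\in\mathfrak{F}'$, then every $\mathbb{T}$-gain graph $\Phi$ on $G$ satisfies $$\lambda_1(A(\Phi))\le\rho(A(\Phi))\le 3\,\lambda_1(A(\Phi)).$$ -/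

import Mathlib

universe u v

noncomputable section

namespace GainGraphs

/-! ### Complex unit gain graphs and their adjacency matrices -/

/-- A `𝕋`-gain graph on the simple graph `G`: a map from the oriented edges of `G` to the complex
unit circle that takes inverse values on the two orientations of the same edge. -/
structure GainGraph {V : Type u} (G : SimpleGraph V) where
  gain : G.Dart → Circle
  gain_symm : ∀ d : G.Dart, gain d.symm = (gain d)⁻¹

open Classical in
/-- The adjacency matrix `A(Φ)` of a `𝕋`-gain graph `Φ`. -/
def GainGraph.adjMatrix {V : Type u} {G : SimpleGraph V} (Φ : GainGraph G) : Matrix V V ℂ :=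
  Matrix.of fun s t => if h : G.Adj s t then (Φ.gain ⟨(s, t), h⟩ : ℂ) else 0

theorem GainGraph.adjMatrix_isHermitian {V : Type u} {G : SimpleGraph V} (Φ : GainGraph G) :
    Φ.adjMatrix.IsHermitian := by
  ext s t
  simp only [Matrix.conjTranspose_apply, GainGraph.adjMatrix, Matrix.of_apply]
  by_cases h : G.Adj s t
  · have h' : G.Adj t s := h.symm
    rw [dif_pos h, dif_pos h']
    have := Φ.gain_symm ⟨(s, t), h⟩
    have e : (SimpleGraph.Dart.symm ⟨(s, t), h⟩ : G.Dart) = ⟨(t, s), h'⟩ := rfl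
    rw [e] at this
    rw [this, Circle.coe_inv_eq_conj]
    simp
  · have h' : ¬ G.Adj t s := fun k => h k.symm
    rw [dif_neg h, dif_neg h']
    simp

/-- The largest eigenvalue `λ₁(A)` of a (nonempty) complex Hermitian matrix. -/
def largestEigenvalue {V : Type u} [Fintype V] [DecidableEq V] {A : Matrix V V ℂ}
    (hA : A.IsHermitian) : ℝ :=
  ⨆ i, hA.eigenvalues i

/-- The spectral radius `ρ(A)` of a complex square matrix, as a real number (the spectrum is a
finite set, so Mathlib's extended-real valued spectral radius is finite). -/
def rho {V : Type u} [Fintype V] [DecidableEq V] (A : Matrix V V ℂ) : ℝ :=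
  (spectralRadius ℂ A).toReal

/-! ### Normal spanning trees and fundamental cycles -/

/-- The tree-order of the tree `T` rooted at `r`: `x` lies on the path of `T` from `r` to `y`. -/
def TreeLE {V : Type u} (T : SimpleGraph V) (r x y : V) : Prop :=
  ∃ p : T.Walk r y, p.IsPath ∧ x ∈ p.support

/-- `T` with root `r` is a normal spanning tree of `G`: adjacent vertices of `G` are comparable in
the tree-order. -/
structure IsNormalSpanningTree {V : Type u} (G T : SimpleGraph V) (r : V) : Prop where
  le : T ≤ G
  isTree : T.IsTree
  comparable : ∀ x y, G.Adj x y → TreeLE T r x y ∨ TreeLE T r y x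

/-- `C` is a fundamental cycle of `G` with respect to `T`: for some edge `e` of `G` outside `T`, it
is the cycle of `T ∪ {e}` (as a subgraph of `G`). -/
def IsFundamentalCycle {V : Type u} {G : SimpleGraph V} (T : SimpleGraph V)
    (C : G.Subgraph) : Prop :=
  ∃ e ∈ G.edgeSet \ T.edgeSet, ∃ (a : V) (w : G.Walk a a),
    w.IsCycle ∧ e ∈ w.edges ∧ (∀ e' ∈ w.edges, e' ∈ T.edgeSet ∨ e' = e) ∧ C = w.toSubgraph

/-! ### Fundamental subgraphs and the distinguished edge property -/

/-- A collection of fundamental cycles whose sum (the union `sSup 𝒞` of these subgraphs) meets the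
spanning tree `T` in a subtree. -/
def IsTreeLikeCollection {V : Type u} {G T : SimpleGraph V} (hT : T ≤ G)
    (𝒞 : Set G.Subgraph) : Prop :=
  (∀ C ∈ 𝒞, IsFundamentalCycle T C) ∧ (sSup 𝒞 ⊓ SimpleGraph.toSubgraph T hT).coe.IsTree

/-- `𝒞` is the collection of the fundamental cycles of a fundamental subgraph `𝔅 = sSup 𝒞` of `G`
with respect to `T`, that is, a maximal collection whose sum meets `T` in a subtree. -/
def IsFundamentalCollection {V : Type u} {G T : SimpleGraph V} (hT : T ≤ G)
    (𝒞 : Set G.Subgraph) : Prop :=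
  Maximal (IsTreeLikeCollection hT) 𝒞

/-- The set of edges of the `i`-th subgraph (counted from `0`) of the sequence `L` that lie neither
in `B` nor in an earlier member of `L`. -/
def newEdges {V : Type u} {G : SimpleGraph V} (B : G.Subgraph) (L : List G.Subgraph)
    (i : Fin L.length) : Set (Sym2 V) :=
  (L.get i).edgeSet \ (B ⊔ sSup {C | C ∈ L.take i}).edgeSet

/-- Distinguished edge property of the fundamental subgraph with collection `𝒞` of fundamental
cycles: they can be arranged in a sequence in which every member but the first has more than one
edge outside the sum of the earlier ones. -/
def HasDEP {V : Type u} {G : SimpleGraph V} (𝒞 : Set G.Subgraph) : Prop :=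
  ∃ L : List G.Subgraph, L.Nodup ∧ {C | C ∈ L} = 𝒞 ∧
    ∀ i : Fin L.length, 1 ≤ (i : ℕ) → 1 < (newEdges ⊥ L i).ncard

/-! ### Subdivisions, and fundamental subgraphs initiated by a subdivision of `K₄` -/

/-- Subdivision of the edge `xy` of `K`: the edge is replaced by a new vertex `none` and two new
edges from it to `x` and to `y`. -/
def subdivideEdge {W : Type u} (K : SimpleGraph W) (x y : W) : SimpleGraph (Option W) :=
  SimpleGraph.fromRel fun a b =>
    (∃ a' b', a = some a' ∧ b = some b' ∧ K.Adj a' b' ∧ s(a', b') ≠ s(x, y)) ∨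
      (a = none ∧ (b = some x ∨ b = some y))

/-- `IsSubdivision K H`: up to isomorphism, `H` is obtained from `K` by a (possibly empty) sequence
of edge subdivisions. -/
inductive IsSubdivision {U : Type v} (K : SimpleGraph U) : {W : Type u} → SimpleGraph W → Prop
  | base {W : Type u} (H : SimpleGraph W) (e : Nonempty (K ≃g H)) : IsSubdivision K H
  | step {W W' : Type u} (H : SimpleGraph W) (H' : SimpleGraph W') (x y : W) (hxy : H.Adj x y)
      (e : Nonempty (subdivideEdge H x y ≃g H')) (h : IsSubdivision K H) : IsSubdivision K H'

/-- Distinguished edge property relative to a subdivision of `K₄`: the collection contains three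
cycles whose sum `K₄'` is `K₄` or a subdivision of `K₄`, and the remaining cycles can be arranged
in a sequence in which every member (including the first) has more than one edge outside the sum of
`K₄'` and the earlier ones. -/
def HasK4DEP {V : Type u} {G : SimpleGraph V} (𝒞 : Set G.Subgraph) : Prop :=
  ∃ C₁ ∈ 𝒞, ∃ C₂ ∈ 𝒞, ∃ C₃ ∈ 𝒞, C₁ ≠ C₂ ∧ C₁ ≠ C₃ ∧ C₂ ≠ C₃ ∧
    IsSubdivision (⊤ : SimpleGraph (Fin 4)) (C₁ ⊔ C₂ ⊔ C₃).coe ∧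
    ∃ L : List G.Subgraph, L.Nodup ∧ {C | C ∈ L} = 𝒞 \ {C₁, C₂, C₃} ∧
      ∀ i : Fin L.length, 1 < (newEdges (C₁ ⊔ C₂ ⊔ C₃) L i).ncard

/-- Extended distinguished edge property: with respect to some normal spanning tree, every
fundamental subgraph has the distinguished edge property, either in its plain form or, when it is
initiated by a subdivision of `K₄`, relative to that subdivision. -/
def HasEDEP {V : Type u} (G : SimpleGraph V) : Prop :=
  ∃ (T : SimpleGraph V) (r : V) (hT : IsNormalSpanningTree G T r),
    ∀ 𝒞 : Set G.Subgraph, IsFundamentalCollection hT.le 𝒞 → HasDEP 𝒞 ∨ HasK4DEP 𝒞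

/-- The class `𝔉′` of connected graphs with the extended distinguished edge property. -/
def EDEPClass (V : Type u) : Set (SimpleGraph V) :=
  {G | G.Connected ∧ HasEDEP G}

end GainGraphs

end

/-! The bound is Hoffman's, applied to a four-colouring. Switching a vector by the three nonconstant
rows of a Hadamard matrix of order four negates the quadratic form in sum and preserves norms, so no
eigenvalue lies below `-3 * λ₁` (`neg_rayleigh_le`). Four-colourability
(`colorable_four_of_hasEDEP`) starts from the bipartite tree `T`, which stays four-colourable with
three edges added (`colorable_four_of_three_edges`). A further cycle with two new edges has a new
tree edge, a bridge of what is already coloured; only this edge and the cycle's non-tree edge cross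
the resulting cut, so permuting colours on one side suffices (`colorable_four_sup_cycle`). By
maximality, distinct fundamental subgraphs are vertex-disjoint, and every edge of `G` outside them
is a bridge. -/

namespace GainGraphs

open Matrix
open scoped ComplexOrder

/-! ### Spectral bounds from a four-colouring. -/

/-- The Rayleigh bound: the quadratic form of a Hermitian matrix is at most its largest eigenvalue
times the squared norm. -/
theorem rayleigh_le {V : Type*} [Fintype V] [DecidableEq V] {A : Matrix V V ℂ}
    (hA : A.IsHermitian) (x : V → ℂ) :
    (star x ⬝ᵥ A *ᵥ x).re ≤ largestEigenvalue hA * ∑ v, ‖x v‖ ^ 2 := by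
  set c : ℝ := largestEigenvalue hA with hc
  have hH : ((algebraMap ℝ (Matrix V V ℂ) c) - A).IsHermitian := by
    refine IsHermitian.sub ?_ hA
    rw [Algebra.algebraMap_eq_smul_one]
    ext i j
    by_cases h : i = j
    · subst h; simp
    · simp [h, Ne.symm h]
  have hP : ((algebraMap ℝ (Matrix V V ℂ) c) - A).PosSemidef := by
    rw [hH.posSemidef_iff_eigenvalues_nonneg]
    intro i
    -- Each eigenvalue of `c - A` is `c` minus an eigenvalue of `A`.
    have h1 := hH.eigenvalues_mem_spectrum_real i
    rw [← spectrum.singleton_sub_eq, hA.spectrum_real_eq_range_eigenvalues] at h1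
    obtain ⟨a, ha, b, ⟨j, rfl⟩, hab⟩ := Set.mem_sub.1 h1
    rw [Set.mem_singleton_iff] at ha
    have : hA.eigenvalues j ≤ c :=
      le_ciSup (f := hA.eigenvalues) (Set.finite_range _).bddAbove j
    simp only [Pi.zero_apply]
    linarith
  have h2 := hP.re_dotProduct_nonneg x
  have h3 : star x ⬝ᵥ (algebraMap ℝ (Matrix V V ℂ) c) *ᵥ x = ((c * ∑ v, ‖x v‖ ^ 2 : ℝ) : ℂ) := by
    rw [Algebra.algebraMap_eq_smul_one, Matrix.smul_mulVec, one_mulVec, dotProduct_smul]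
    simp [dotProduct, Complex.conj_mul']
  rw [sub_mulVec, dotProduct_sub, h3] at h2
  simp only [RCLike.re_to_complex, Complex.sub_re, Complex.ofReal_re] at h2
  linarith

/-- The sign vectors attached to the four colours: the rows, other than the constant one, of a
Hadamard matrix of order four. -/
def hadamardSign : Fin 3 → Fin 4 → ℝ :=
  ![![1, 1, -1, -1], ![1, -1, 1, -1], ![1, -1, -1, 1]]

/-- Columns of the full Hadamard matrix are orthogonal, and the omitted constant row contributes
`1`. -/
theorem sum_hadamardSign_of_ne {a b : Fin 4} (h : a ≠ b) :
    ∑ k, hadamardSign k a * hadamardSign k b = -1 := by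
  fin_cases a <;> fin_cases b <;> simp_all [hadamardSign, Fin.sum_univ_three]

theorem norm_hadamardSign (k : Fin 3) (a : Fin 4) : |hadamardSign k a| = 1 := by
  fin_cases k <;> fin_cases a <;> simp [hadamardSign]

/-- Hoffman's argument for four colours: switching signs along the rows of a Hadamard matrix turns
the quadratic form of a four-partite Hermitian matrix into its negative. -/
theorem neg_rayleigh_le {V : Type*} [Fintype V] [DecidableEq V] {A : Matrix V V ℂ}
    (hA : A.IsHermitian) (c : V → Fin 4) (hc : ∀ s t, c s = c t → A s t = 0) (x : V → ℂ) :
    -(star x ⬝ᵥ A *ᵥ x).re ≤ 3 * largestEigenvalue hA * ∑ v, ‖x v‖ ^ 2 := by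
  let y : Fin 3 → V → ℂ := fun k v => (hadamardSign k (c v) : ℂ) * x v
  have h1 : ∑ k, star (y k) ⬝ᵥ A *ᵥ (y k) = -(star x ⬝ᵥ A *ᵥ x) := by
    simp only [dotProduct, mulVec, Finset.mul_sum, Pi.star_apply, ← Finset.sum_neg_distrib]
    rw [Finset.sum_comm]
    refine Finset.sum_congr rfl fun s _ => ?_
    rw [Finset.sum_comm]
    refine Finset.sum_congr rfl fun t _ => ?_
    by_cases h : c s = c t
    · simp [hc s t h]
    · have h2 : (∑ k, (hadamardSign k (c s) : ℂ) * (hadamardSign k (c t) : ℂ)) = -1 := by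
        exact_mod_cast congrArg (fun r : ℝ => (r : ℂ)) (sum_hadamardSign_of_ne h)
      rw [← neg_one_mul, ← h2, Finset.sum_mul]
      refine Finset.sum_congr rfl fun k _ => ?_
      simp only [y, star_mul', RCLike.star_def, Complex.conj_ofReal]
      ring
  have h3 : ∀ k, ∑ v, ‖y k v‖ ^ 2 = ∑ v, ‖x v‖ ^ 2 := fun k => by
    refine Finset.sum_congr rfl fun v _ => ?_
    simp [y, norm_hadamardSign]
  -- The constant `3` counts the sign vectors: one Rayleigh bound for each, all with the same norm.
  have h4 := Finset.sum_le_sum fun k (_ : k ∈ Finset.univ) => rayleigh_le hA (y k)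
  rw [← Complex.re_sum, h1] at h4
  simp only [h3] at h4
  simp only [Complex.neg_re, Finset.sum_const, Finset.card_univ, Fintype.card_fin,
    nsmul_eq_mul] at h4
  push_cast at h4
  linarith

theorem largestEigenvalue_nonneg {V : Type*} [Fintype V] [DecidableEq V] [Nonempty V]
    {A : Matrix V V ℂ} (hA : A.IsHermitian) (h0 : ∀ v, A v v = 0) :
    0 ≤ largestEigenvalue hA := by
  obtain ⟨v⟩ := ‹Nonempty V›
  have := rayleigh_le hA (Pi.single v 1)
  have h2 : ∑ w, ‖(Pi.single v 1 : V → ℂ) w‖ ^ 2 = 1 := by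
    rw [Finset.sum_eq_single v] <;> simp +contextual
  rw [h2, ← Pi.single_star] at this
  simpa [h0] using this

theorem le_rho {V : Type*} [Fintype V] [DecidableEq V] [Nonempty V] {A : Matrix V V ℂ}
    (hA : A.IsHermitian) {r : ℝ} (hr : ∀ i, |hA.eigenvalues i| ≤ r) :
    largestEigenvalue hA ≤ rho A ∧ rho A ≤ r := by
  have hspec : spectralRadius ℂ A = ⨆ i, (‖hA.eigenvalues i‖₊ : ENNReal) := by
    rw [spectralRadius, hA.spectrum_eq_image_range, iSup_image, iSup_range]
    simp
  have hr0 : 0 ≤ r := (abs_nonneg _).trans (hr (Classical.arbitrary V))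
  have hle : spectralRadius ℂ A ≤ ENNReal.ofReal r := by
    rw [hspec]
    refine iSup_le fun i => ?_
    rw [← enorm_eq_nnnorm, ← ofReal_norm]
    exact ENNReal.ofReal_le_ofReal (hr i)
  -- Finiteness keeps `toReal` monotone here; at `⊤` it would return `0`.
  have hfin : spectralRadius ℂ A ≠ ⊤ := (hle.trans_lt ENNReal.ofReal_lt_top).ne
  constructor
  · refine ciSup_le fun i => (le_abs_self _).trans ?_
    have h1 : (‖hA.eigenvalues i‖₊ : ENNReal) ≤ spectralRadius ℂ A := by
      rw [hspec]; exact le_iSup (fun i => (‖hA.eigenvalues i‖₊ : ENNReal)) i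
    have := ENNReal.toReal_mono hfin h1
    simpa [rho] using this
  · have := ENNReal.toReal_mono ENNReal.ofReal_ne_top hle
    rwa [ENNReal.toReal_ofReal hr0] at this

theorem abs_eigenvalues_le {V : Type*} [Fintype V] [DecidableEq V] {A : Matrix V V ℂ}
    (hA : A.IsHermitian) (c : V → Fin 4) (hc : ∀ s t, c s = c t → A s t = 0) (i : V) :
    |hA.eigenvalues i| ≤ 3 * largestEigenvalue hA := by
  have : Nonempty V := ⟨i⟩
  -- Nonnegativity gives `λ₁ ≤ 3 * λ₁`, which settles the upper side; the lower side tests the form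
  -- on a unit eigenvector.
  have h0 := largestEigenvalue_nonneg hA fun v => hc v v rfl
  have h1 : hA.eigenvalues i ≤ largestEigenvalue hA :=
    le_ciSup (f := hA.eigenvalues) (Set.finite_range _).bddAbove i
  have h2 := neg_rayleigh_le hA c hc (hA.eigenvectorBasis i).ofLp
  have h3 : ∑ v, ‖(hA.eigenvectorBasis i).ofLp v‖ ^ 2 = 1 := by
    rw [← EuclideanSpace.norm_sq_eq, (hA.eigenvectorBasis).orthonormal.1 i, one_pow]
  have h4 : -(hA.eigenvalues i) ≤ 3 * largestEigenvalue hA := by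
    have h5 := hA.eigenvalues_eq i
    simp only [RCLike.re_to_complex] at h5
    rw [dotProduct_comm] at h5
    rw [h3, mul_one, dotProduct_comm, ← h5] at h2
    exact h2
  rw [abs_le]
  constructor <;> linarith

/-- For a four-colourable graph the spectral radius of a `𝕋`-gain graph is at most three times
its largest eigenvalue. -/
theorem rho_le_of_colorable {V : Type*} [Fintype V] [DecidableEq V] [Nonempty V]
    {G : SimpleGraph V} (hG : G.Colorable 4) (Φ : GainGraph G) :
    largestEigenvalue Φ.adjMatrix_isHermitian ≤ rho Φ.adjMatrix ∧
      rho Φ.adjMatrix ≤ 3 * largestEigenvalue Φ.adjMatrix_isHermitian := by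
  obtain ⟨c⟩ := hG
  refine le_rho _ (abs_eigenvalues_le _ c fun s t hst => ?_)
  have : ¬ G.Adj s t := fun h => c.valid h hst
  simp [GainGraph.adjMatrix, this]



/-! ### Reachability and recolouring -/

theorem reachable_of_forall_adj {V : Type*} {K K' : SimpleGraph V}
    (h : ∀ a b, K.Adj a b → K'.Reachable a b) {x y : V} (hxy : K.Reachable x y) :
    K'.Reachable x y := by
  obtain ⟨p⟩ := hxy
  induction p with
  | nil => rfl
  | cons hab _ ih => exact (h _ _ hab).trans ih

theorem mem_iff_of_reachable {V : Type*} {K : SimpleGraph V} {S : Set V}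
    (h : ∀ a b, K.Adj a b → (a ∈ S ↔ b ∈ S)) {x y : V} (hxy : K.Reachable x y) :
    x ∈ S ↔ y ∈ S := by
  obtain ⟨p⟩ := hxy
  induction p with
  | nil => rfl
  | cons hab _ ih => exact (h _ _ hab).trans ih

theorem exists_perm_ne : ∀ a b c d : Fin 4, ∃ π : Equiv.Perm (Fin 4), a ≠ π b ∧ c ≠ π d := by
  decide

/-- A four-colouring extends over a cut with at most two edges, by permuting the colours on one
side of the cut. -/
theorem colorable_four_of_cut {V : Type*} {H H' : SimpleGraph V} (hH : H.Colorable 4) (S : Set V)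
    {x y u v : V} (hx : x ∉ S) (hy : y ∈ S) (hu : u ∉ S) (hv : v ∈ S)
    (hcut : ∀ a b, H'.Adj a b →
      (H.Adj a b ∧ (a ∈ S ↔ b ∈ S)) ∨ s(a, b) = s(x, y) ∨ s(a, b) = s(u, v)) :
    H'.Colorable 4 := by
  classical
  obtain ⟨c⟩ := hH
  obtain ⟨π, h1, h2⟩ := exists_perm_ne (c x) (c y) (c u) (c v)
  refine ⟨SimpleGraph.Coloring.mk (fun a => if a ∈ S then π (c a) else c a) ?_⟩
  intro a b hab
  rcases hcut a b hab with ⟨h3, h4⟩ | h | h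
  · have h5 := c.valid h3
    by_cases ha : a ∈ S
    · simpa [ha, h4.1 ha] using h5
    · simpa [ha, mt h4.2 ha] using h5
  · rcases Sym2.eq_iff.1 h with ⟨rfl, rfl⟩ | ⟨rfl, rfl⟩
    · simpa [hx, hy] using h1
    · simpa [hx, hy] using h1.symm
  · rcases Sym2.eq_iff.1 h with ⟨rfl, rfl⟩ | ⟨rfl, rfl⟩
    · simpa [hu, hv] using h2
    · simpa [hu, hv] using h2.symm

/-- The vertices `p` and `q` receive the private colours `2` and `3`; the edges that avoid both lie
in `T` and keep its two colours. -/
theorem colorable_four_of_cover {V : Type*} {T H : SimpleGraph V} (hT : T.Colorable 2) (p q : V)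
    (h : ∀ a b, H.Adj a b → T.Adj a b ∨ p ∈ s(a, b) ∨ q ∈ s(a, b)) : H.Colorable 4 := by
  classical
  obtain ⟨c⟩ := hT
  have hc : ∀ a, Fin.castLE (by norm_num : 2 ≤ 4) (c a) ≠ 2 ∧
      Fin.castLE (by norm_num : 2 ≤ 4) (c a) ≠ 3 := fun a => by
    generalize c a = i
    revert i
    decide
  refine ⟨SimpleGraph.Coloring.mk (fun a => if a = p then 2 else if a = q then 3 else
    Fin.castLE (by norm_num : 2 ≤ 4) (c a)) ?_⟩
  intro a b hab
  have hne := hab.ne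
  have h1 := h a b hab
  simp only [Sym2.mem_iff] at h1
  have h2 : T.Adj a b → Fin.castLE (by norm_num : 2 ≤ 4) (c a) ≠
      Fin.castLE (by norm_num : 2 ≤ 4) (c b) := fun h => by simpa using c.valid h
  have h3 := hc a
  have h4 := hc b
  have h5 : (2 : Fin 4) ≠ 3 := by decide
  split_ifs <;> grind

/-- A bipartite graph together with three further edges is four-colourable. -/
theorem colorable_four_of_three_edges {V : Type*} {T H : SimpleGraph V} (hT : T.Colorable 2)
    (u v : Fin 3 → V)
    (h : ∀ a b, H.Adj a b → T.Adj a b ∨ ∃ i, s(a, b) = s(u i, v i)) : H.Colorable 4 := by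
  classical
  -- If two of the edges share a vertex in this way, two vertices cover all three edges. Otherwise
  -- no `v l` is a `u i`, and membership in `Set.range u` is a second colour bit that separates the
  -- ends of every added edge.
  by_cases hs : ∃ i j, i ≠ j ∧ u i = v j
  · obtain ⟨i, j, hij, huv⟩ := hs
    obtain ⟨k, hk⟩ : ∃ k, ∀ l : Fin 3, l = i ∨ l = j ∨ l = k := by
      clear huv
      revert i j
      decide
    refine colorable_four_of_cover hT (u i) (u k) fun a b hab => ?_
    rcases h a b hab with h1 | ⟨l, hl⟩
    · exact Or.inl h1
    · rw [hl]
      rcases hk l with rfl | rfl | rfl <;> simp [huv]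
  · push Not at hs
    obtain ⟨c⟩ := hT
    let c' : H.Coloring (Fin 2 × Bool) :=
      SimpleGraph.Coloring.mk (fun a => (c a, decide (a ∈ Set.range u))) (by
        intro a b hab
        rcases h a b hab with h1 | ⟨l, hl⟩
        · have := c.valid h1
          simp [this]
        · have hne : u l ≠ v l := by
            rintro h
            rw [h, Sym2.eq_iff] at hl
            exact hab.ne (by rcases hl with ⟨rfl, rfl⟩ | ⟨rfl, rfl⟩ <;> rfl)
          have hv : v l ∉ Set.range u := by
            rintro ⟨i, hi⟩
            by_cases hil : i = l
            · subst hil; exact hne hi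
            · exact hs i l hil hi
          have hu : u l ∈ Set.range u := ⟨l, rfl⟩
          have hu' := decide_eq_true hu
          have hv' := decide_eq_false hv
          rcases Sym2.eq_iff.1 hl with ⟨rfl, rfl⟩ | ⟨rfl, rfl⟩
          · rw [hu', hv']; simp
          · rw [hu', hv']; simp)
    simpa using c'.colorable

/-- Adding bridges preserves four-colourability. -/
theorem colorable_four_of_bridges {V : Type*} [Finite V] {H G : SimpleGraph V} (hle : H ≤ G)
    (hb : ∀ a b, G.Adj a b → ¬ H.Adj a b → G.IsBridge s(a, b)) (hH : H.Colorable 4) :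
    G.Colorable 4 := by
  induction G using WellFoundedLT.induction with
  | ind G ih =>
    by_cases hex : ∃ a b, G.Adj a b ∧ ¬ H.Adj a b
    · obtain ⟨x, y, hG, hnH⟩ := hex
      have hbr := hb x y hG hnH
      have hlt : G.deleteEdges {s(x, y)} < G := by
        refine lt_of_le_of_ne (SimpleGraph.deleteEdges_le _) fun h => ?_
        rw [← h] at hG
        simp at hG
      have hc := ih _ hlt (fun a b hab => by
          rw [SimpleGraph.deleteEdges_adj]
          refine ⟨hle hab, fun h => hnH ?_⟩
          rwa [← SimpleGraph.mem_edgeSet, ← Set.mem_singleton_iff.1 h])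
        (fun a b hab hn => (hb a b (SimpleGraph.deleteEdges_le _ hab) hn).anti hlt.le)
      rw [SimpleGraph.isBridge_iff] at hbr
      -- Only one edge crosses the cut, so it fills both slots.
      refine colorable_four_of_cut hc
        {a | (G.deleteEdges {s(x, y)}).Reachable y a} (x := x) (y := y) (u := x) (v := y)
        (fun h => hbr h.symm) (SimpleGraph.Reachable.refl _)
        (fun h => hbr h.symm) (SimpleGraph.Reachable.refl _) fun a b hab => ?_
      by_cases he : s(a, b) = s(x, y)
      · exact Or.inr (Or.inl he)
      · have hadj : (G.deleteEdges {s(x, y)}).Adj a b := by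
          rw [SimpleGraph.deleteEdges_adj]; exact ⟨hab, he⟩
        exact Or.inl ⟨hadj, fun h => h.trans hadj.reachable, fun h => h.trans hadj.symm.reachable⟩
    · push Not at hex
      exact hH.mono_left fun a b => hex a b

/-! ### Fundamental cycles -/

/-- `C` consists of the edge `uv` outside `T` and of edges of `T`. -/
structure IsCycleThrough {V : Type*} {G : SimpleGraph V} (T : SimpleGraph V) (C : G.Subgraph)
    (u v : V) : Prop where
  adj : C.Adj u v
  not_adj : ¬ T.Adj u v
  adj_or : ∀ x y, C.Adj x y → T.Adj x y ∨ s(x, y) = s(u, v)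
  reachable : ∀ x y, C.Adj x y → (C.spanningCoe.deleteEdges {s(x, y)}).Reachable x y
  connected : C.Connected

theorem IsFundamentalCycle.exists_isCycleThrough {V : Type*} {G T : SimpleGraph V}
    {C : G.Subgraph} (hC : IsFundamentalCycle T C) : ∃ u v, IsCycleThrough T C u v := by
  obtain ⟨e, ⟨-, heT⟩, a, w, hw, hew, hall, rfl⟩ := hC
  induction e with | h u v =>
  refine ⟨u, v, SimpleGraph.Walk.adj_toSubgraph_iff_mem_edges.2 hew, heT, fun x y hxy =>
    hall _ (SimpleGraph.Walk.adj_toSubgraph_iff_mem_edges.1 hxy), fun x y hxy => ?_,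
    w.toSubgraph_connected⟩
  have hsub : ∀ e ∈ w.edges, e ∈ w.toSubgraph.spanningCoe.edgeSet := fun e he => by
    simpa using he
  by_contra hr
  have hbr : w.toSubgraph.spanningCoe.IsBridge s(x, y) := hr
  refine hbr.notMem_edges_of_isCycle (hw.transfer hsub) ?_
  rw [SimpleGraph.Walk.edges_transfer]
  exact SimpleGraph.Walk.adj_toSubgraph_iff_mem_edges.1 hxy

theorem exists_isFundamentalCycle {V : Type*} {G T : SimpleGraph V} (hle : T ≤ G)
    (hT : T.Connected) {x y : V} (hG : G.Adj x y) (hn : ¬ T.Adj x y) :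
    ∃ C : G.Subgraph, IsFundamentalCycle T C ∧ C.Adj x y := by
  obtain ⟨p, hp⟩ := hT.exists_isPath y x
  have hpT : ∀ e ∈ (p.mapLe hle).edges, e ∈ T.edgeSet := fun e he => by
    rw [SimpleGraph.Walk.edges_mapLe_eq_edges] at he
    exact p.edges_subset_edgeSet he
  refine ⟨(SimpleGraph.Walk.cons hG (p.mapLe hle)).toSubgraph,
    ⟨s(x, y), ⟨hG, hn⟩, x, _, ?_, by simp, ?_, rfl⟩, by simp⟩
  · rw [SimpleGraph.Walk.cons_isCycle_iff]
    exact ⟨hp.mapLe hle, fun h => hn (hpT _ h)⟩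
  · intro e he
    rw [SimpleGraph.Walk.edges_cons, List.mem_cons] at he
    exact he.symm.imp (hpT e) id

/-- The ends of every edge of `B` are joined in the common part of `B` and `T`. -/
def IsSpannedBy {V : Type*} {G : SimpleGraph V} (T : SimpleGraph V) (B : G.Subgraph) : Prop :=
  ∀ x y, B.Adj x y → (T ⊓ B.spanningCoe).Reachable x y

/-- Deleting the only non-tree edge of the cycle leaves its ends joined by tree edges. -/
theorem IsFundamentalCycle.isSpannedBy {V : Type*} {G T : SimpleGraph V} {C : G.Subgraph}
    (hC : IsFundamentalCycle T C) : IsSpannedBy T C := by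
  obtain ⟨u, v, h⟩ := hC.exists_isCycleThrough
  intro x y hxy
  by_cases hT : T.Adj x y
  · exact SimpleGraph.Adj.reachable ⟨hT, hxy⟩
  · refine (h.reachable x y hxy).mono fun a b hab => ?_
    rw [SimpleGraph.deleteEdges_adj] at hab
    refine ⟨(h.adj_or a b hab.1).resolve_right fun he => hab.2 ?_, hab.1⟩
    rw [Set.mem_singleton_iff, he, (h.adj_or x y hxy).resolve_left hT]

theorem isSpannedBy_sSup {V : Type*} {G T : SimpleGraph V} {𝒞 : Set G.Subgraph}
    (h : ∀ C ∈ 𝒞, IsSpannedBy T C) : IsSpannedBy T (sSup 𝒞) := by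
  intro x y hxy
  obtain ⟨C, hC, hC'⟩ := SimpleGraph.Subgraph.sSup_adj.1 hxy
  exact (h C hC x y hC').mono
    (inf_le_inf_left _ (SimpleGraph.Subgraph.spanningCoe_le_of_le (le_sSup hC)))

theorem IsSpannedBy.sup {V : Type*} {G T : SimpleGraph V} {B C : G.Subgraph}
    (hB : IsSpannedBy T B) (hC : IsSpannedBy T C) : IsSpannedBy T (B ⊔ C) := by
  rw [← sSup_pair]
  refine isSpannedBy_sSup ?_
  rintro D (rfl | rfl) <;> assumption

/-- The edges of `T` outside a subgraph spanned by `T` are bridges of the union. -/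
theorem IsSpannedBy.isBridge {V : Type*} {G T : SimpleGraph V} {B : G.Subgraph}
    (hT : T.IsAcyclic) (hB : IsSpannedBy T B) {x y : V} (hxy : T.Adj x y) (hn : ¬ B.Adj x y) :
    (T ⊔ B.spanningCoe).IsBridge s(x, y) := by
  have h := SimpleGraph.isAcyclic_iff_forall_adj_isBridge.1 hT hxy
  rw [SimpleGraph.isBridge_iff] at h ⊢
  -- An edge of `B` can be rerouted along tree edges inside `B`, none of which is `xy`; a detour
  -- around `xy` would thus exist already in `T`.
  refine fun hr => h (reachable_of_forall_adj (fun a b hab => ?_) hr)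
  rw [SimpleGraph.deleteEdges_adj] at hab
  rcases hab with ⟨h1 | h1, h2⟩
  · exact SimpleGraph.Adj.reachable (SimpleGraph.deleteEdges_adj.2 ⟨h1, h2⟩)
  · refine (hB a b h1).mono fun c d hcd => ?_
    refine SimpleGraph.deleteEdges_adj.2 ⟨hcd.1, fun he => hn ?_⟩
    have h3 : s(c, d) ∈ B.edgeSet := hcd.2
    rw [Set.mem_singleton_iff.1 he] at h3
    exact h3

/-- A fundamental cycle with a new tree edge can be added to a four-coloured graph. -/
theorem colorable_four_sup_cycle {V : Type*} {G T : SimpleGraph V} (hT : T.IsAcyclic)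
    {B C : G.Subgraph} (hB : IsSpannedBy T B) (hC : IsFundamentalCycle T C)
    (hnew : 1 < (C.edgeSet \ B.edgeSet).ncard) (hcol : (T ⊔ B.spanningCoe).Colorable 4) :
    (T ⊔ (B ⊔ C).spanningCoe).Colorable 4 := by
  obtain ⟨u, v, hC⟩ := hC.exists_isCycleThrough
  -- Of two new edges, at most one is the non-tree edge `uv`, so another is a tree edge `xy`.
  obtain ⟨f, ⟨hfC, hfB⟩, hfe⟩ := Set.exists_ne_of_one_lt_ncard hnew s(u, v)
  induction f with | h x y =>
  have hCxy : C.Adj x y := hfC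
  have hBxy : ¬ B.Adj x y := hfB
  have hTxy : T.Adj x y := (hC.adj_or x y hCxy).resolve_right hfe
  have hbr := hB.isBridge hT hTxy hBxy
  rw [SimpleGraph.isBridge_iff] at hbr
  set K := (T ⊔ B.spanningCoe).deleteEdges {s(x, y)} with hK
  let S : Set V := {a | K.Reachable y a}
  have hS : ∀ a b, K.Adj a b → (a ∈ S ↔ b ∈ S) := fun a b hab =>
    ⟨fun h => h.trans hab.reachable, fun h => h.trans hab.symm.reachable⟩
  have hx : x ∉ S := fun h => hbr h.symm
  have hy : y ∈ S := SimpleGraph.Reachable.refl _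
  -- Were `u` and `v` on the same side, the rest of the cycle, which joins `x` to `y`, would never
  -- cross the cut.
  have hcross : ¬ (u ∈ S ↔ v ∈ S) := by
    refine fun huv => hx ((mem_iff_of_reachable (fun a b hab => ?_) (hC.reachable x y hCxy)).2 hy)
    rw [SimpleGraph.deleteEdges_adj] at hab
    rcases hC.adj_or a b hab.1 with h | h
    · exact hS a b (SimpleGraph.deleteEdges_adj.2 ⟨Or.inl h, hab.2⟩)
    · rcases Sym2.eq_iff.1 h with ⟨rfl, rfl⟩ | ⟨rfl, rfl⟩
      · exact huv
      · exact huv.symm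
  have hcut : ∀ a b, (T ⊔ (B ⊔ C).spanningCoe).Adj a b →
      ((T ⊔ B.spanningCoe).Adj a b ∧ (a ∈ S ↔ b ∈ S)) ∨
        s(a, b) = s(x, y) ∨ s(a, b) = s(u, v) := by
    intro a b hab
    by_cases he : s(a, b) = s(x, y)
    · exact Or.inr (Or.inl he)
    · have key : (T ⊔ B.spanningCoe).Adj a b → ((T ⊔ B.spanningCoe).Adj a b ∧ (a ∈ S ↔ b ∈ S)) :=
        fun h => ⟨h, hS a b (SimpleGraph.deleteEdges_adj.2 ⟨h, he⟩)⟩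
      rcases hab with h | h | h
      · exact Or.inl (key (Or.inl h))
      · exact Or.inl (key (Or.inr h))
      · rcases hC.adj_or a b h with h | h
        · exact Or.inl (key (Or.inl h))
        · exact Or.inr (Or.inr h)
  by_cases hu : u ∈ S
  · have hv : v ∉ S := fun hv => hcross ⟨fun _ => hv, fun _ => hu⟩
    refine colorable_four_of_cut hcol S hx hy hv hu fun a b hab => ?_
    rw [Sym2.eq_swap (a := v)]
    exact hcut a b hab
  · have hv : v ∈ S := by
      by_contra hv
      exact hcross ⟨fun h => absurd h hu, fun h => absurd h hv⟩
    exact colorable_four_of_cut hcol S hx hy hu hv hcut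

theorem colorable_four_sup_three {V : Type*} {G T : SimpleGraph V} (hT : T.IsAcyclic)
    {C : Fin 3 → G.Subgraph} (hC : ∀ i, IsFundamentalCycle T (C i)) :
    (T ⊔ (C 0 ⊔ C 1 ⊔ C 2).spanningCoe).Colorable 4 := by
  choose u v h using fun i => (hC i).exists_isCycleThrough
  refine colorable_four_of_three_edges hT.colorable_two u v fun a b hab => ?_
  rcases hab with h1 | (h1 | h1) | h1
  · exact Or.inl h1
  · exact ((h 0).adj_or a b h1).imp_right fun h => ⟨0, h⟩
  · exact ((h 1).adj_or a b h1).imp_right fun h => ⟨1, h⟩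
  · exact ((h 2).adj_or a b h1).imp_right fun h => ⟨2, h⟩

/-- Absorbing the head into the base lets the induction on the list run with `B` generalized. -/
theorem newEdges_cons_succ {V : Type*} {G : SimpleGraph V} (B C : G.Subgraph)
    (L : List G.Subgraph) (i : Fin L.length) :
    newEdges B (C :: L) i.succ = newEdges (B ⊔ C) L i := by
  have : {D | D ∈ (C :: L).take (i + 1)} = insert C {D | D ∈ L.take i} := by
    ext D; simp
  simp [newEdges, Set.union_assoc]

theorem colorable_four_sup_list {V : Type*} {G T : SimpleGraph V} (hT : T.IsAcyclic)
    (L : List G.Subgraph) : ∀ (B : G.Subgraph), IsSpannedBy T B →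
      (∀ C ∈ L, IsFundamentalCycle T C) → (∀ i, 1 < (newEdges B L i).ncard) →
      (T ⊔ B.spanningCoe).Colorable 4 →
      (T ⊔ (B ⊔ sSup {C | C ∈ L}).spanningCoe).Colorable 4 := by
  induction L with
  | nil =>
    intro B _ _ _ hcol
    simpa using hcol
  | cons C L ih =>
    intro B hB hL hnew hcol
    have hC := hL C List.mem_cons_self
    have h0 : newEdges B (C :: L) ⟨0, by simp⟩ = C.edgeSet \ B.edgeSet := by
      simp [newEdges]
    have h1 := ih (B ⊔ C) (hB.sup hC.isSpannedBy) (fun D hD => hL D (List.mem_cons_of_mem _ hD))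
      (fun i => newEdges_cons_succ B C L i ▸ hnew i.succ)
      (colorable_four_sup_cycle hT hB hC (h0 ▸ hnew ⟨0, by simp⟩) hcol)
    have h2 : {D | D ∈ C :: L} = insert C {D | D ∈ L} := by ext D; simp
    rwa [h2, sSup_insert, ← sup_assoc]

/-- A sum of fundamental cycles with either form of the distinguished edge property is
four-colourable. -/
theorem colorable_four_sSup {V : Type*} {G T : SimpleGraph V} (hT : T.IsAcyclic)
    {𝒞 : Set G.Subgraph} (h𝒞 : ∀ C ∈ 𝒞, IsFundamentalCycle T C) (h : HasDEP 𝒞 ∨ HasK4DEP 𝒞) :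
    (sSup 𝒞).spanningCoe.Colorable 4 := by
  -- The whole tree is kept throughout, since the bridge argument lives in `T ⊔ B`.
  suffices (T ⊔ (sSup 𝒞).spanningCoe).Colorable 4 from this.mono_left le_sup_right
  rcases h with ⟨L, -, rfl, hL⟩ | ⟨C₁, h₁, C₂, h₂, C₃, h₃, -, -, -, -, L, -, hL𝒞, hL⟩
  · cases L with
    | nil => simpa using hT.colorable_two.mono (by norm_num)
    | cons C L =>
      have hC := h𝒞 C List.mem_cons_self
      -- A single starting cycle is the three-cycle case with repetitions.
      have h0 := colorable_four_sup_three hT (C := fun _ => C) fun _ => hC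
      rw [sup_idem, sup_idem] at h0
      have h1 := colorable_four_sup_list hT L C hC.isSpannedBy
        (fun D hD => h𝒞 D (List.mem_cons_of_mem _ hD)) (fun i => by
          have := hL i.succ (by simp)
          rwa [newEdges_cons_succ, bot_sup_eq] at this) h0
      have h2 : {D | D ∈ C :: L} = insert C {D | D ∈ L} := by ext D; simp
      rwa [h2, sSup_insert]
  · have h0 := colorable_four_sup_three hT (C := ![C₁, C₂, C₃]) fun i => by
      fin_cases i <;> simp [h𝒞, h₁, h₂, h₃]
    have h1 := colorable_four_sup_list hT L (C₁ ⊔ C₂ ⊔ C₃)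
      (((h𝒞 _ h₁).isSpannedBy.sup (h𝒞 _ h₂).isSpannedBy).sup (h𝒞 _ h₃).isSpannedBy)
      (fun D hD => h𝒞 D ((Set.ext_iff.1 hL𝒞 D).1 hD).1) hL h0
    refine h1.mono_left (sup_le_sup_left (SimpleGraph.Subgraph.spanningCoe_le_of_le ?_) _)
    refine sSup_le fun D hD => ?_
    by_cases hD' : D ∈ ({C₁, C₂, C₃} : Set G.Subgraph)
    · refine le_sup_of_le_left ?_
      rcases hD' with rfl | rfl | rfl
      · exact le_sup_of_le_left le_sup_left
      · exact le_sup_of_le_left le_sup_right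
      · exact le_sup_right
    · exact le_sup_of_le_right (le_sSup ((Set.ext_iff.1 hL𝒞 D).2 ⟨hD, hD'⟩))

/-! ### Fundamental collections -/

theorem isAcyclic_coe_inf_toSubgraph {V : Type*} {G T : SimpleGraph V} (hle : T ≤ G)
    (hT : T.IsAcyclic) (B : G.Subgraph) :
    (B ⊓ SimpleGraph.toSubgraph T hle).coe.IsAcyclic :=
  hT.comap ⟨Subtype.val, fun h => h.2⟩ Subtype.val_injective

theorem connected_of_spanningCoe_reachable {V : Type*} {G : SimpleGraph V} {X : G.Subgraph}
    (hne : X.verts.Nonempty)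
    (h : ∀ u ∈ X.verts, ∀ v ∈ X.verts, X.spanningCoe.Reachable u v) : X.Connected := by
  rw [SimpleGraph.Subgraph.connected_iff, SimpleGraph.Subgraph.preconnected_iff]
  refine ⟨?_, hne⟩
  rintro ⟨u, hu⟩ ⟨v, hv⟩
  obtain ⟨p⟩ := h u hu v hv
  induction p with
  | nil => rfl
  | @cons u w v hab _ ih =>
    have hw : w ∈ X.verts := X.edge_vert (SimpleGraph.Subgraph.Adj.symm hab)
    have hadj : X.coe.Adj ⟨u, hu⟩ ⟨w, hw⟩ := hab
    exact hadj.reachable.trans (ih hw hv)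

theorem IsFundamentalCycle.isTreeLikeCollection_singleton {V : Type*} {G T : SimpleGraph V}
    (hle : T ≤ G) (hT : T.IsAcyclic) {C : G.Subgraph} (hC : IsFundamentalCycle T C) :
    IsTreeLikeCollection hle {C} := by
  refine ⟨by simpa using hC, ?_, isAcyclic_coe_inf_toSubgraph hle hT _⟩
  rw [sSup_singleton]
  obtain ⟨a, b, h⟩ := hC.exists_isCycleThrough
  refine (connected_of_spanningCoe_reachable (X := C ⊓ SimpleGraph.toSubgraph T hle)
    ⟨a, C.edge_vert h.adj, trivial⟩ fun u hu v hv => ?_).coe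
  have h1 : C.spanningCoe.Reachable u v :=
    (h.connected.coe ⟨u, hu.1⟩ ⟨v, hv.1⟩).map ⟨Subtype.val, fun h => h⟩
  refine reachable_of_forall_adj (fun x y hxy => ?_) h1
  refine (hC.isSpannedBy x y hxy).mono ?_
  exact fun c d hcd => ⟨hcd.2, hcd.1⟩

theorem IsTreeLikeCollection.union {V : Type*} {G T : SimpleGraph V}
    {hle : T ≤ G} (hT : T.IsAcyclic) {𝒞 𝒟 : Set G.Subgraph} (h𝒞 : IsTreeLikeCollection hle 𝒞)
    (h𝒟 : IsTreeLikeCollection hle 𝒟) {v : V} (hv : v ∈ (sSup 𝒞).verts)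
    (hv' : v ∈ (sSup 𝒟).verts) : IsTreeLikeCollection hle (𝒞 ∪ 𝒟) := by
  refine ⟨fun C hC => hC.elim (h𝒞.1 C) (h𝒟.1 C), ?_, isAcyclic_coe_inf_toSubgraph hle hT _⟩
  rw [sSup_union, inf_sup_right]
  exact (SimpleGraph.Subgraph.connected_sup ⟨h𝒞.2.connected.preconnected⟩
    ⟨h𝒟.2.connected.preconnected⟩ ⟨v, ⟨hv, trivial⟩, ⟨hv', trivial⟩⟩).coe

/-- A shared vertex makes the union tree-like, and maximality makes both collections equal to it. -/
theorem IsFundamentalCollection.eq_of_mem_verts {V : Type*} {G T : SimpleGraph V}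
    {hle : T ≤ G} (hT : T.IsAcyclic) {𝒞 𝒟 : Set G.Subgraph}
    (h𝒞 : IsFundamentalCollection hle 𝒞) (h𝒟 : IsFundamentalCollection hle 𝒟) {v : V}
    (hv : v ∈ (sSup 𝒞).verts) (hv' : v ∈ (sSup 𝒟).verts) : 𝒞 = 𝒟 := by
  have h := h𝒞.prop.union hT h𝒟.prop hv hv'
  rw [h𝒞.eq_of_subset h Set.subset_union_left, ← h𝒟.eq_of_subset h Set.subset_union_right]

theorem IsFundamentalCycle.exists_isFundamentalCollection {V : Type*} [Finite V]
    {G T : SimpleGraph V} (hle : T ≤ G) (hT : T.IsAcyclic) {C : G.Subgraph}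
    (hC : IsFundamentalCycle T C) : ∃ 𝒞, IsFundamentalCollection hle 𝒞 ∧ C ∈ 𝒞 := by
  obtain ⟨𝒞, h1, h2⟩ := (Set.toFinite {𝒞 | IsTreeLikeCollection hle 𝒞}).exists_le_maximal
    (hC.isTreeLikeCollection_singleton hle hT)
  exact ⟨𝒞, h2, h1 rfl⟩

/-- Vertex-disjoint four-colourable subgraphs have a four-colourable union. -/
theorem colorable_four_iUnion {V ι : Type*} {G H : SimpleGraph V} (B : ι → G.Subgraph)
    (hB : ∀ i, (B i).spanningCoe.Colorable 4)
    (hdisj : ∀ i j v, v ∈ (B i).verts → v ∈ (B j).verts → i = j)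
    (hH : ∀ a b, H.Adj a b → ∃ i, (B i).Adj a b) : H.Colorable 4 := by
  classical
  let c : ∀ i, (B i).spanningCoe.Coloring (Fin 4) := fun i => (hB i).some
  -- The default `0` falls on vertices outside every `B i`, which are isolated in `H`.
  let col : V → Fin 4 := fun v => if h : ∃ i, v ∈ (B i).verts then c h.choose v else 0
  have hcol : ∀ i v, v ∈ (B i).verts → col v = c i v := fun i v hv => by
    have h : ∃ i, v ∈ (B i).verts := ⟨i, hv⟩
    have h1 : h.choose = i := hdisj _ _ v h.choose_spec hv
    simp only [col, dif_pos h]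
    rw [h1]
  refine ⟨SimpleGraph.Coloring.mk col ?_⟩
  intro a b hab
  obtain ⟨i, hi⟩ := hH a b hab
  rw [hcol i a ((B i).edge_vert hi), hcol i b ((B i).edge_vert hi.symm)]
  exact (c i).valid hi

/-- Graphs with the extended distinguished edge property are four-colourable. -/
theorem colorable_four_of_hasEDEP {V : Type*} [Finite V] {G : SimpleGraph V} (hG : HasEDEP G) :
    G.Colorable 4 := by
  obtain ⟨T, r, hT, hF⟩ := hG
  have hac := hT.isTree.isAcyclic
  let B : G.Subgraph := sSup {C | IsFundamentalCycle T C}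
  have hB : IsSpannedBy T B := isSpannedBy_sSup fun C hC => IsFundamentalCycle.isSpannedBy hC
  have hcolB : B.spanningCoe.Colorable 4 := by
    refine colorable_four_iUnion
      (fun 𝒞 : {𝒞 : Set G.Subgraph // IsFundamentalCollection hT.le 𝒞} => sSup 𝒞.1)
      (fun 𝒞 => colorable_four_sSup hac 𝒞.2.prop.1 (hF 𝒞.1 𝒞.2))
      (fun 𝒞 𝒟 v hv hv' => Subtype.ext (𝒞.2.eq_of_mem_verts hac 𝒟.2 hv hv')) fun a b hab => ?_
    obtain ⟨C, hC, hCab⟩ := SimpleGraph.Subgraph.sSup_adj.1 hab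
    obtain ⟨𝒞, h𝒞, hmem⟩ := IsFundamentalCycle.exists_isFundamentalCollection hT.le hac hC
    exact ⟨⟨𝒞, h𝒞⟩, SimpleGraph.Subgraph.sSup_adj.2 ⟨C, hmem, hCab⟩⟩
  have hor : ∀ a b, G.Adj a b → T.Adj a b ∨ B.Adj a b := fun a b hab => by
    by_cases h : T.Adj a b
    · exact Or.inl h
    · obtain ⟨C, hC, hCab⟩ := exists_isFundamentalCycle hT.le hT.isTree.connected hab h
      exact Or.inr (SimpleGraph.Subgraph.sSup_adj.2 ⟨C, hC, hCab⟩)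
  -- An edge of `G` outside `B` lies in `T`, hence is a bridge of `T ⊔ B`, which contains `G`.
  refine colorable_four_of_bridges B.spanningCoe_le (fun a b hab hn => ?_) hcolB
  exact (hB.isBridge hac ((hor a b hab).resolve_right hn) hn).anti hor

end GainGraphs

theorem theorem5p2 {V : Type*} [Fintype V] [DecidableEq V] (G : SimpleGraph V)
    (hG : G ∈ GainGraphs.EDEPClass V) (Φ : GainGraphs.GainGraph G) :
    GainGraphs.largestEigenvalue Φ.adjMatrix_isHermitian ≤ GainGraphs.rho Φ.adjMatrix ∧
      GainGraphs.rho Φ.adjMatrix ≤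
        3 * GainGraphs.largestEigenvalue Φ.adjMatrix_isHermitian := by
  have := hG.1.nonempty
  exact GainGraphs.rho_le_of_colorable (GainGraphs.colorable_four_of_hasEDEP hG.2) Φ
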